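/- A difference--restriction algebra is a nonempty algebra $(A,-,\triangleright)$ with two binary operations that is representable, i.e. isomorphic to an algebra of partial functions from some set $X$ to some set $Y$ in which $f-g=\{p\in f : p\notin g\}$ is relative complement and $f\triangleright g=\{(x,y)\in g : x\in\operatorname{dom} f\}$ is domain restriction. Its order is given by $a\le b \iff a-(a-b)=a$; elements $a,b$ are compatible if $a\triangleright b=b\triangleright a$; and it is finitarily compatibly complete if every finite set of pairwise compatible elements has a join. Homomorphisms of such algebras are the maps preserving $-$ and $\triangleright$. Likewise, a representable $\{-,\triangleright,\sqcup\}$-algebra is a nonempty algebra isomorphic to an algebra of partial functions with the operations $-$, $\triangleright$ as above and preferential union $f\sqcup g=\{(x,y) : (x,y)\in f \text{ or } ((x,y)\in g \text{ and } x\notin\operatorname{dom} f)\}$; homomorphisms are the maps preserving all three operations. A Hausdorff étale space is a surjective local homeomorphism $\pi\colon X\to X_0$ with $X$ and $X_0$ Hausdorff. A morphism from $\pi\colon X\to X_0$ to $\rho\colon Y\to Y_0$ is a partial function $\varphi$ from $X$ to $Y$ such that preimages of open sets are open, preimages of compact sets are compact, and: (1) if $\varphi(x),\varphi(x')$ are defined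 and $\pi(x)=\pi(x')$, then $\rho(\varphi(x))=\rho(\varphi(x'))$; (2) if $\varphi(x)=\varphi(x')$ are defined and $\pi(x)=\pi(x')$, then $x=x'$; (3) if $\varphi(x)$ is defined and $\rho(y')=\rho(\varphi(x))$, then there is $x'$ with $\pi(x')=\pi(x)$ and $\varphi(x')=y'$. The étale space is called locally compact zero-dimensional if every point of $X$ has a neighbourhood basis of compact sets and a neighbourhood basis of clopen sets. Theorem. The category of representable $\{-,\triangleright,\sqcup\}$-algebras and their homomorphisms is dually equivalent to the category of locally compact zero-dimensional Hausdorff étale spaces (a full subcategory of the category of Hausdorff étale spaces). Moreover, forgetting $\sqcup$ is an isomorphism of categories from the representable $\{-,\triangleright,\sqcup\}$-algebras onto the full subcategory of finitarily compatibly complete difference--restriction algebras. -/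

import Mathlib

open CategoryTheory

universe u

/-! ### Partial functions and the operations on them -/

section PartialFunctions

variable {X Y : Type u}

/-- A set of pairs is (the graph of) a partial function from `X` to `Y`. -/
def IsPartialFun (f : Set (X × Y)) : Prop :=
  ∀ x y z, (x, y) ∈ f → (x, z) ∈ f → y = z

/-- The domain of a partial function. -/
def pfDom (f : Set (X × Y)) : Set X :=
  {x | ∃ y, (x, y) ∈ f}

/-- Relative complement `f - g`. -/
def pfDiff (f g : Set (X × Y)) : Set (X × Y) :=
  {p | p ∈ f ∧ p ∉ g}

/-- Domain restriction `f ▷ g`: the restriction of `g` to the domain of `f`. -/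
def pfRest (f g : Set (X × Y)) : Set (X × Y) :=
  {p | p.1 ∈ pfDom f ∧ p ∈ g}

/-- Preferential union (override) of `f` and `g`. -/
def pfPref (f g : Set (X × Y)) : Set (X × Y) :=
  {p | p ∈ f ∨ (p ∈ g ∧ p.1 ∉ pfDom f)}

/-- `θ` is a representation of the `{-, ▷}`-algebra `(A, diff, rest)`: an isomorphism onto an
algebra of partial functions from `X` to `Y`, that is, an injective map into partial functions
taking the abstract operations to the concrete ones (its image is then closed under these). -/
structure IsDRRepresentation {A : Type u} (diff rest : A → A → A) (θ : A → Set (X × Y)) :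
    Prop where
  injective : Function.Injective θ
  isPartialFun : ∀ a, IsPartialFun (θ a)
  map_diff : ∀ a b, θ (diff a b) = pfDiff (θ a) (θ b)
  map_rest : ∀ a b, θ (rest a b) = pfRest (θ a) (θ b)

/-- `θ` is a representation of the `{-, ▷, ⊔}`-algebra `(A, diff, rest, pref)`, where the third
symbol is to be interpreted as preferential union. -/
structure IsPrefRepresentation {A : Type u} (diff rest pref : A → A → A) (θ : A → Set (X × Y)) :
    Prop extends IsDRRepresentation diff rest θ where
  map_pref : ∀ a b, θ (pref a b) = pfPref (θ a) (θ b)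

end PartialFunctions

/-! ### Difference-restriction algebras -/

/-- Difference-restriction algebras: (nonempty) representable `{-, ▷}`-algebras. -/
structure DRAlg : Type (u + 1) where
  carrier : Type u
  diff : carrier → carrier → carrier
  rest : carrier → carrier → carrier
  nonempty : Nonempty carrier
  representable : ∃ (X Y : Type u) (θ : carrier → Set (X × Y)), IsDRRepresentation diff rest θ

namespace DRAlg

/-- Homomorphisms of `{-, ▷}`-algebras. -/
@[ext]
structure Hom (A B : DRAlg.{u}) : Type u where
  toFun : A.carrier → B.carrier
  map_diff : ∀ a b, toFun (A.diff a b) = B.diff (toFun a) (toFun b)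
  map_rest : ∀ a b, toFun (A.rest a b) = B.rest (toFun a) (toFun b)

instance : Category.{u} DRAlg.{u} where
  Hom A B := Hom A B
  id A := ⟨fun a => a, fun _ _ => rfl, fun _ _ => rfl⟩
  comp f g := ⟨fun a => g.toFun (f.toFun a),
    fun a b => by rw [f.map_diff, g.map_diff], fun a b => by rw [f.map_rest, g.map_rest]⟩

/-- The order of a difference-restriction algebra: `a ≤ b` iff `a · b = a`, where
`a · b = a - (a - b)`. -/
instance (A : DRAlg.{u}) : LE A.carrier :=
  ⟨fun a b => A.diff a (A.diff a b) = a⟩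

/-- Compatibility of two elements. -/
def Compatible (A : DRAlg.{u}) (a b : A.carrier) : Prop :=
  A.rest a b = A.rest b a

/-- `A` is finitarily compatibly complete: every finite set of pairwise compatible elements has
a join. -/
def FinCompComplete : ObjectProperty DRAlg.{u} := fun A =>
  ∀ S : Set A.carrier, S.Finite → (∀ a ∈ S, ∀ b ∈ S, A.Compatible a b) → ∃ j, IsLUB S j

end DRAlg

/-- The category of finitarily compatibly complete difference-restriction algebras, a full
subcategory of `DRAlg`. -/
abbrev CfinDRAlg : Type (u + 1) := DRAlg.FinCompComplete.{u}.FullSubcategory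

/-! ### Representable algebras with preferential union -/

/-- (Nonempty) representable `{-, ▷, ⊔}`-algebras, `⊔` being preferential union. -/
structure PrefAlg : Type (u + 1) where
  carrier : Type u
  diff : carrier → carrier → carrier
  rest : carrier → carrier → carrier
  pref : carrier → carrier → carrier
  nonempty : Nonempty carrier
  representable : ∃ (X Y : Type u) (θ : carrier → Set (X × Y)),
    IsPrefRepresentation diff rest pref θ

namespace PrefAlg

/-- Homomorphisms of `{-, ▷, ⊔}`-algebras. -/
@[ext]
structure Hom (A B : PrefAlg.{u}) : Type u where
  toFun : A.carrier → B.carrier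
  map_diff : ∀ a b, toFun (A.diff a b) = B.diff (toFun a) (toFun b)
  map_rest : ∀ a b, toFun (A.rest a b) = B.rest (toFun a) (toFun b)
  map_pref : ∀ a b, toFun (A.pref a b) = B.pref (toFun a) (toFun b)

instance : Category.{u} PrefAlg.{u} where
  Hom A B := Hom A B
  id A := ⟨fun a => a, fun _ _ => rfl, fun _ _ => rfl, fun _ _ => rfl⟩
  comp f g := ⟨fun a => g.toFun (f.toFun a),
    fun a b => by rw [f.map_diff, g.map_diff], fun a b => by rw [f.map_rest, g.map_rest],
    fun a b => by rw [f.map_pref, g.map_pref]⟩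

/-- The functor forgetting preferential union. -/
def forgetPref : PrefAlg.{u} ⥤ DRAlg.{u} where
  obj A :=
    { carrier := A.carrier
      diff := A.diff
      rest := A.rest
      nonempty := A.nonempty
      representable := by
        obtain ⟨X, Y, θ, hθ⟩ := A.representable
        exact ⟨X, Y, θ, hθ.toIsDRRepresentation⟩ }
  map f := ⟨f.toFun, f.map_diff, f.map_rest⟩

end PrefAlg

/-! ### Hausdorff étale spaces -/

/-- Hausdorff étale spaces: surjective local homeomorphisms between Hausdorff spaces. -/
structure HausEt : Type (u + 1) where
  X : Type u
  X₀ : Type u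
  [topX : TopologicalSpace X]
  [topX₀ : TopologicalSpace X₀]
  [t2X : T2Space X]
  [t2X₀ : T2Space X₀]
  proj : X → X₀
  isLocalHomeomorph : IsLocalHomeomorph proj
  surjective : Function.Surjective proj

namespace HausEt

attribute [instance] topX topX₀ t2X t2X₀

/-- Morphisms of Hausdorff étale spaces: continuous and proper partial functions between the
total spaces that preserve equivalence and are fibrewise injective and fibrewise surjective. -/
@[ext]
structure Hom (E F : HausEt.{u}) : Type u where
  toPFun : E.X →. F.X
  continuous : PContinuous toPFun
  proper : ∀ K : Set F.X, IsCompact K → IsCompact (toPFun.preimage K)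
  preserves_equiv : ∀ x x' y y', y ∈ toPFun x → y' ∈ toPFun x' →
    E.proj x = E.proj x' → F.proj y = F.proj y'
  fibre_injective : ∀ x x' y, y ∈ toPFun x → y ∈ toPFun x' → E.proj x = E.proj x' → x = x'
  fibre_surjective : ∀ x y, y ∈ toPFun x → ∀ y', F.proj y' = F.proj y →
    ∃ x', E.proj x' = E.proj x ∧ y' ∈ toPFun x'

/-- The identity morphism. -/
def Hom.id (E : HausEt.{u}) : Hom E E where
  toPFun := PFun.id E.X
  continuous s hs := by rw [← PFun.coe_id, PFun.coe_preimage]; exact hs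
  proper K hK := by rw [← PFun.coe_id, PFun.coe_preimage]; exact hK
  preserves_equiv x x' y y' hy hy' h := by
    simp only [PFun.id_apply, Part.mem_some_iff] at hy hy'
    rw [hy, hy', h]
  fibre_injective x x' y hy hy' _ := by
    simp only [PFun.id_apply, Part.mem_some_iff] at hy hy'
    rw [← hy, ← hy']
  fibre_surjective x y hy y' h := by
    simp only [PFun.id_apply, Part.mem_some_iff] at hy ⊢
    exact ⟨y', by rw [h, hy], rfl⟩

/-- Composition of morphisms is composition of partial functions. -/
def Hom.comp {E F G : HausEt.{u}} (φ : Hom E F) (ψ : Hom F G) : Hom E G where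
  toPFun := ψ.toPFun.comp φ.toPFun
  continuous s hs := by
    rw [PFun.preimage_comp]; exact φ.continuous _ (ψ.continuous _ hs)
  proper K hK := by
    rw [PFun.preimage_comp]; exact φ.proper _ (ψ.proper _ hK)
  preserves_equiv x x' z z' hz hz' h := by
    rw [PFun.comp_apply] at hz hz'
    obtain ⟨y, hy, hz⟩ := Part.mem_bind_iff.1 hz
    obtain ⟨y', hy', hz'⟩ := Part.mem_bind_iff.1 hz'
    exact ψ.preserves_equiv _ _ _ _ hz hz' (φ.preserves_equiv _ _ _ _ hy hy' h)
  fibre_injective x x' z hz hz' h := by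
    rw [PFun.comp_apply] at hz hz'
    obtain ⟨y, hy, hz⟩ := Part.mem_bind_iff.1 hz
    obtain ⟨y', hy', hz'⟩ := Part.mem_bind_iff.1 hz'
    have e := ψ.fibre_injective _ _ _ hz hz' (φ.preserves_equiv _ _ _ _ hy hy' h)
    subst e
    exact φ.fibre_injective _ _ _ hy hy' h
  fibre_surjective x z hz z' h := by
    rw [PFun.comp_apply] at hz
    obtain ⟨y, hy, hz⟩ := Part.mem_bind_iff.1 hz
    obtain ⟨y', hy', hz'⟩ := ψ.fibre_surjective _ _ hz z' h
    obtain ⟨x', hx', hxy'⟩ := φ.fibre_surjective _ _ hy y' hy'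
    refine ⟨x', hx', ?_⟩
    rw [PFun.comp_apply]
    exact Part.mem_bind_iff.2 ⟨y', hxy', hz'⟩

instance : Category.{u} HausEt.{u} where
  Hom E F := Hom E F
  id E := Hom.id E
  comp φ ψ := Hom.comp φ ψ
  id_comp φ := Hom.ext (PFun.comp_id φ.toPFun)
  comp_id φ := Hom.ext (PFun.id_comp φ.toPFun)
  assoc φ ψ χ := Hom.ext (PFun.comp_assoc χ.toPFun ψ.toPFun φ.toPFun).symm

/-- The total space is locally compact and zero-dimensional: every point has a neighbourhood
basis of compact sets, and a neighbourhood basis of clopen sets. -/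
def LocallyCompactZeroDim : ObjectProperty HausEt.{u} := fun E =>
  (∀ x : E.X, ∀ U ∈ nhds x, ∃ K ∈ nhds x, K ⊆ U ∧ IsCompact K) ∧
  (∀ x : E.X, ∀ U ∈ nhds x, ∃ V ∈ nhds x, V ⊆ U ∧ IsClopen V)

end HausEt

/-- The category of locally compact zero-dimensional Hausdorff étale spaces, a full subcategory
of `HausEt`. -/
abbrev StoneEt : Type (u + 1) := HausEt.LocallyCompactZeroDim.{u}.FullSubcategory

/-! Stone duality. A space is sent to its algebra of compact open sets on which the projection is
injective, and a morphism to its preimage map. The functor is full and faithful because these sets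
form a basis of a Hausdorff space: a point is determined by the sections containing it, and
compactness produces a point from the sections whose images under a homomorphism contain a given `x`
(`exists_isValue`). Domain restriction sees only the projection, so its preservation gives
compatibility with fibres and fibrewise surjectivity.

For essential surjectivity, the points over an algebra are its maximal filters `p`, and the
projection sends `p` to the set of `a` whose domain is large for `p`, that is, `a ▷ b ∈ p` for any
`b ∈ p` (`trace_eq`). An element `a` gives the section `basic a`. Every compact open section arises
in this way (`toSections_surjective`), since preferential union glues a finite cover.

The second statement holds because `a ⊔ b` is the join of the compatible elements `a` and `b - (a ▷
b)`, hence is determined by the order, and joins of pairs are unions in every representation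
(`representation_of_isLUB`). -/

/-! ### The algebra of compact open sections -/

namespace HausEt

open Set

/-- Compact open sets on which the projection is injective: images of compact open local
sections. -/
structure IsCompactOpenSection (E : HausEt.{u}) (U : Set E.X) : Prop where
  isCompact : IsCompact U
  isOpen : IsOpen U
  injOn : InjOn E.proj U

namespace IsCompactOpenSection

variable {E F : HausEt.{u}} {U V : Set E.X}

theorem empty : E.IsCompactOpenSection ∅ :=
  ⟨isCompact_empty, isOpen_empty, injOn_empty _⟩

theorem diff (hU : E.IsCompactOpenSection U) (hV : E.IsCompactOpenSection V) :
    E.IsCompactOpenSection (U \ V) :=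
  ⟨hU.isCompact.diff hV.isOpen, hU.isOpen.sdiff hV.isCompact.isClosed,
    hU.injOn.mono sdiff_subset⟩

theorem isOpen_saturation (hU : E.IsCompactOpenSection U) :
    IsOpen (E.proj ⁻¹' (E.proj '' U)) :=
  (E.isLocalHomeomorph.isOpenMap _ hU.isOpen).preimage E.isLocalHomeomorph.continuous

/-- The image of a compact set is closed in the Hausdorff base. With `isOpen_saturation`,
saturations are clopen, so cutting a section by one keeps it compact and open. -/
theorem isClosed_saturation (hU : E.IsCompactOpenSection U) :
    IsClosed (E.proj ⁻¹' (E.proj '' U)) :=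
  (hU.isCompact.image E.isLocalHomeomorph.continuous).isClosed.preimage
    E.isLocalHomeomorph.continuous

theorem rest (hU : E.IsCompactOpenSection U) (hV : E.IsCompactOpenSection V) :
    E.IsCompactOpenSection (V ∩ E.proj ⁻¹' (E.proj '' U)) :=
  ⟨hV.isCompact.inter_right hU.isClosed_saturation, hV.isOpen.inter hU.isOpen_saturation,
    hV.injOn.mono inter_subset_left⟩

theorem pref (hU : E.IsCompactOpenSection U) (hV : E.IsCompactOpenSection V) :
    E.IsCompactOpenSection (U ∪ V \ E.proj ⁻¹' (E.proj '' U)) := by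
  refine ⟨hU.isCompact.union (hV.isCompact.diff hU.isOpen_saturation),
    hU.isOpen.union (hV.isOpen.sdiff hU.isClosed_saturation), ?_⟩
  rintro x (hx | hx) y (hy | hy) h
  · exact hU.injOn hx hy h
  · exact (hy.2 ⟨x, hx, h⟩).elim
  · exact (hx.2 ⟨y, hy, h.symm⟩).elim
  · exact hV.injOn hx.1 hy.1 h

theorem preimage (φ : E ⟶ F) {W : Set F.X} (hW : F.IsCompactOpenSection W) :
    E.IsCompactOpenSection (Hom.toPFun φ |>.preimage W) := by
  refine ⟨Hom.proper φ _ hW.isCompact, Hom.continuous φ _ hW.isOpen, ?_⟩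
  rintro x ⟨y, hy, hxy⟩ x' ⟨y', hy', hxy'⟩ h
  obtain rfl := hW.injOn hy hy' (Hom.preserves_equiv φ _ _ _ _ hxy hxy' h)
  exact Hom.fibre_injective φ _ _ _ hxy hxy' h

end IsCompactOpenSection

/-- In a locally compact zero-dimensional étale space, the compact open sections form a basis. -/
theorem LocallyCompactZeroDim.exists_section {E : HausEt.{u}} (hE : LocallyCompactZeroDim E)
    {x : E.X} {O : Set E.X} (hO : IsOpen O) (hx : x ∈ O) :
    ∃ U, E.IsCompactOpenSection U ∧ x ∈ U ∧ U ⊆ O := by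
  obtain ⟨e, hxe, he⟩ := E.isLocalHomeomorph x
  obtain ⟨K, hK, hKO, hKc⟩ := hE.1 x (O ∩ e.source) ((hO.inter e.open_source).mem_nhds ⟨hx, hxe⟩)
  obtain ⟨V, hV, hVK, hVc⟩ := hE.2 x K hK
  refine ⟨V, ⟨hKc.of_isClosed_subset hVc.isClosed hVK, hVc.isOpen, ?_⟩, mem_of_mem_nhds hV,
    fun y hy => (hKO (hVK hy)).1⟩
  rw [he]
  exact e.injOn.mono fun y hy => (hKO (hVK hy)).2

/-- The `{-, ▷, ⊔}`-algebra of compact open sections of an étale space. -/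
def sectionAlgebra (E : HausEt.{u}) : PrefAlg.{u} where
  carrier := {U : Set E.X // E.IsCompactOpenSection U}
  diff U V := ⟨U.1 \ V.1, U.2.diff V.2⟩
  rest U V := ⟨V.1 ∩ E.proj ⁻¹' (E.proj '' U.1), U.2.rest V.2⟩
  pref U V := ⟨U.1 ∪ V.1 \ E.proj ⁻¹' (E.proj '' U.1), U.2.pref V.2⟩
  nonempty := ⟨⟨∅, .empty⟩⟩
  representable := by
    have hdom : ∀ (U : Set E.X) x, x ∈ pfDom {p : E.X₀ × E.X | p.2 ∈ U ∧ E.proj p.2 = p.1} ↔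
      x ∈ E.proj '' U := fun U x => Iff.rfl
    -- A section is represented by the inverse of the projection restricted to it, a partial
    -- function from the base to the total space.
    refine ⟨E.X₀, E.X, fun U => {p | p.2 ∈ U.1 ∧ E.proj p.2 = p.1}, ⟨⟨?_, ?_, ?_, ?_⟩, ?_⟩⟩
    · intro U V h
      ext x
      simpa using Set.ext_iff.1 h (E.proj x, x)
    · rintro U x y z ⟨hy, h⟩ ⟨hz, h'⟩
      exact U.2.injOn hy hz (h.trans h'.symm)
    · rintro U V
      ext ⟨z, x⟩
      simp only [pfDiff, mem_ofPred_eq, mem_sdiff]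
      tauto
    · rintro U V
      ext ⟨z, x⟩
      simp only [pfRest, mem_ofPred_eq, hdom, mem_inter_iff, mem_preimage]
      constructor
      · rintro ⟨h, rfl⟩
        exact ⟨h.2, h.1, rfl⟩
      · rintro ⟨h, h', rfl⟩
        exact ⟨⟨h', h⟩, rfl⟩
    · rintro U V
      ext ⟨z, x⟩
      simp only [pfPref, mem_ofPred_eq, hdom, mem_union, mem_sdiff, mem_preimage]
      constructor
      · rintro ⟨h, rfl⟩
        tauto
      · rintro (⟨h, rfl⟩ | ⟨⟨h, rfl⟩, h'⟩) <;> tauto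

variable {E F : HausEt.{u}}

theorem Hom.mem_unique (φ : Hom E F) {x : E.X} {y y' : F.X} (h : y ∈ φ.toPFun x)
    (h' : y' ∈ φ.toPFun x) : y = y' :=
  Part.mem_unique h h'

/-- Preimages of the saturation of a set are saturations of preimages. -/
theorem Hom.proj_mem_image_preimage_iff (φ : Hom E F) (U : Set F.X) {x : E.X} {y : F.X}
    (h : y ∈ φ.toPFun x) :
    E.proj x ∈ E.proj '' φ.toPFun.preimage U ↔ F.proj y ∈ F.proj '' U := by
  constructor
  · rintro ⟨x', ⟨y', hy', hxy'⟩, hx'⟩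
    exact ⟨y', hy', φ.preserves_equiv _ _ _ _ hxy' h hx'⟩
  · rintro ⟨y', hy', hyy'⟩
    obtain ⟨x', hx', hxy'⟩ := φ.fibre_surjective _ _ h y' hyy'
    exact ⟨x', ⟨y', hy', hxy'⟩, hx'⟩

/-- Taking preimages under a morphism of étale spaces is a homomorphism. -/
def Hom.preimageHom (φ : Hom E F) : PrefAlg.Hom F.sectionAlgebra E.sectionAlgebra where
  toFun U := ⟨φ.toPFun.preimage U.1, .preimage φ U.2⟩
  map_diff U V := by
    refine Subtype.ext (Set.ext fun x => ?_)
    constructor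
    · rintro ⟨y, ⟨hU, hV⟩, h⟩
      refine ⟨⟨y, hU, h⟩, ?_⟩
      rintro ⟨y', hV', h'⟩
      exact hV (φ.mem_unique h h' ▸ hV')
    · rintro ⟨⟨y, hU, h⟩, hV⟩
      exact ⟨y, ⟨hU, fun hy => hV ⟨y, hy, h⟩⟩, h⟩
  map_rest U V := by
    refine Subtype.ext (Set.ext fun x => ?_)
    constructor
    · rintro ⟨y, ⟨hV, hU⟩, h⟩
      exact ⟨⟨y, hV, h⟩, (φ.proj_mem_image_preimage_iff _ h).2 hU⟩
    · rintro ⟨⟨y, hV, h⟩, hU⟩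
      exact ⟨y, ⟨hV, (φ.proj_mem_image_preimage_iff _ h).1 hU⟩, h⟩
  map_pref U V := by
    refine Subtype.ext (Set.ext fun x => ?_)
    constructor
    · rintro ⟨y, hU | ⟨hV, hU⟩, h⟩
      · exact Or.inl ⟨y, hU, h⟩
      · exact Or.inr ⟨⟨y, hV, h⟩, fun h' => hU ((φ.proj_mem_image_preimage_iff _ h).1 h')⟩
    · rintro (⟨y, hU, h⟩ | ⟨⟨y, hV, h⟩, hU⟩)
      · exact ⟨y, Or.inl hU, h⟩
      · exact ⟨y, Or.inr ⟨hV, fun h' => hU ((φ.proj_mem_image_preimage_iff _ h).2 h')⟩, h⟩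

end HausEt

/-- The contravariant functor taking a locally compact zero-dimensional étale space to its algebra
of compact open sections. -/
def sectionFunctor : StoneEt.{u} ⥤ PrefAlg.{u}ᵒᵖ where
  obj E := Opposite.op E.obj.sectionAlgebra
  map φ := Quiver.Hom.op (V := PrefAlg.{u}) (HausEt.Hom.preimageHom φ.hom)
  map_id E := by
    refine Quiver.Hom.unop_inj (PrefAlg.Hom.ext (funext fun U => Subtype.ext ?_))
    exact PFun.coe_preimage _root_.id U.1
  map_comp φ ψ := by
    refine Quiver.Hom.unop_inj (PrefAlg.Hom.ext (funext fun U => Subtype.ext ?_))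
    exact PFun.preimage_comp _ _ _

/-! ### Homomorphisms between algebras of compact open sections come from morphisms -/

namespace HausEt

open Set

variable {E F : HausEt.{u}}

/-- The complement of `z` is open, so if `y ≠ z` some section contains `y` and misses `z`. One
implication suffices. -/
theorem LocallyCompactZeroDim.eq_of_forall (hF : LocallyCompactZeroDim F) {y z : F.X}
    (h : ∀ U, F.IsCompactOpenSection U → y ∈ U → z ∈ U) : y = z := by
  by_contra hne
  obtain ⟨V, hV, hyV, hVz⟩ := hF.exists_section (isOpen_compl_singleton (x := z))
    (hne : y ∈ ({z} : Set F.X)ᶜ)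
  exact hVz (h V hV hyV) rfl

theorem Hom.ext_of_preimage (hF : LocallyCompactZeroDim F) {φ ψ : Hom E F}
    (h : φ.preimageHom = ψ.preimageHom) : φ = ψ := by
  have hpre : ∀ U, F.IsCompactOpenSection U → φ.toPFun.preimage U = ψ.toPFun.preimage U :=
    fun U hU => congrArg Subtype.val (congrFun (congrArg PrefAlg.Hom.toFun h) ⟨U, hU⟩)
  have key : ∀ φ ψ : Hom E F,
      (∀ U, F.IsCompactOpenSection U → φ.toPFun.preimage U = ψ.toPFun.preimage U) →
      ∀ x y, y ∈ φ.toPFun x → y ∈ ψ.toPFun x := by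
    intro φ ψ h x y hxy
    obtain ⟨U, hU, hyU, -⟩ := hF.exists_section isOpen_univ (mem_univ y)
    have hx : x ∈ φ.toPFun.preimage U := ⟨y, hyU, hxy⟩
    rw [h U hU] at hx
    obtain ⟨z, -, hxz⟩ := hx
    suffices z = y from this ▸ hxz
    refine (hF.eq_of_forall fun V hV hyV => ?_).symm
    have hx : x ∈ φ.toPFun.preimage V := ⟨y, hyV, hxy⟩
    rw [h V hV] at hx
    obtain ⟨w, hwV, hxw⟩ := hx
    exact ψ.mem_unique hxw hxz ▸ hwV
  refine Hom.ext (PFun.ext fun x y => ?_)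
  exact ⟨key φ ψ hpre x y, key ψ φ (fun U hU => (hpre U hU).symm) x y⟩

section OfHom

variable (h : PrefAlg.Hom F.sectionAlgebra E.sectionAlgebra)

/-- `y` is the value at `x` of the partial function whose preimage map is `h`. -/
def IsValue (x : E.X) (y : F.X) : Prop :=
  (∃ U, x ∈ (h.toFun U).1) ∧ ∀ U, x ∈ (h.toFun U).1 ↔ y ∈ U.1

variable {h}

theorem mem_hom_diff {U V : F.sectionAlgebra.carrier} {x : E.X} :
    x ∈ (h.toFun (F.sectionAlgebra.diff U V)).1 ↔
      x ∈ (h.toFun U).1 ∧ x ∉ (h.toFun V).1 := by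
  rw [h.map_diff]; rfl

theorem mem_hom_rest {U V : F.sectionAlgebra.carrier} {x : E.X} :
    x ∈ (h.toFun (F.sectionAlgebra.rest U V)).1 ↔
      x ∈ (h.toFun V).1 ∧ ∃ x' ∈ (h.toFun U).1, E.proj x' = E.proj x := by
  rw [h.map_rest]; rfl

theorem exists_isValue {x : E.X} {U₀ : F.sectionAlgebra.carrier} (hx : x ∈ (h.toFun U₀).1) :
    ∃ y, IsValue h x y := by
  -- The sections whose image contains `x` have a common point by compactness.
  let ι := {U : F.sectionAlgebra.carrier // x ∈ (h.toFun U).1}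
  have hne : Nonempty ι := ⟨⟨U₀, hx⟩⟩
  have hnonempty : (⋂ U : ι, U.1.1).Nonempty := by
    refine IsCompact.nonempty_iInter_of_directed_nonempty_isCompact_isClosed
      (fun U : ι => U.1.1) ?_ ?_ (fun U => U.1.2.isCompact) (fun U => U.1.2.isCompact.isClosed)
    · intro U V
      refine ⟨⟨F.sectionAlgebra.diff U.1 (F.sectionAlgebra.diff U.1 V.1), ?_⟩, ?_, ?_⟩
      · rw [mem_hom_diff, mem_hom_diff]
        exact ⟨U.2, fun h' => h'.2 V.2⟩
      · exact fun y hy => hy.1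
      · exact fun y hy => by_contra fun h' => hy.2 ⟨hy.1, h'⟩
    · rintro ⟨U, hU⟩
      by_contra hempty
      -- The empty section satisfies `U - U = U`, so its image under `h` is empty and cannot contain
      -- `x`.
      have hUU : F.sectionAlgebra.diff U U = U := by
        refine Subtype.ext ?_
        change U.1 \ U.1 = U.1
        rw [not_nonempty_iff_eq_empty.1 hempty, sdiff_self]
      have hU' := hU
      rw [← hUU, mem_hom_diff] at hU'
      exact hU'.2 hU
  obtain ⟨y, hy⟩ := hnonempty
  rw [mem_iInter] at hy
  refine ⟨y, ⟨U₀, hx⟩, fun U => ⟨fun hU => hy ⟨U, hU⟩, fun hU => ?_⟩⟩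
  by_contra hxU
  -- If `x` is not in the image of `U`, it is in that of `U₀ - U`, so the common point `y` avoids
  -- `U`.
  exact (hy ⟨F.sectionAlgebra.diff U₀ U, mem_hom_diff.2 ⟨hx, hxU⟩⟩).2 hU

variable (h) in
/-- The partial function whose preimage map is `h`. -/
noncomputable def valuePFun : E.X →. F.X := fun x =>
  ⟨∃ y, IsValue h x y, fun hx => hx.choose⟩

theorem mem_valuePFun (hF : LocallyCompactZeroDim F) {x : E.X} {y : F.X} :
    y ∈ valuePFun h x ↔ IsValue h x y := by
  constructor
  · rintro ⟨hx, rfl⟩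
    exact hx.choose_spec
  · intro hy
    have hx : ∃ y, IsValue h x y := ⟨y, hy⟩
    refine ⟨hx, hF.eq_of_forall fun U hU hyU => ?_⟩
    exact (hy.2 ⟨U, hU⟩).1 ((hx.choose_spec.2 ⟨U, hU⟩).2 hyU)

theorem preimage_valuePFun (hF : LocallyCompactZeroDim F) (U : F.sectionAlgebra.carrier) :
    (valuePFun h).preimage U.1 = (h.toFun U).1 := by
  ext x
  constructor
  · rintro ⟨y, hy, hxy⟩
    exact (((mem_valuePFun hF).1 hxy).2 U).2 hy
  · intro hx
    obtain ⟨y, hy⟩ := exists_isValue hx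
    exact ⟨y, (hy.2 U).1 hx, (mem_valuePFun hF).2 hy⟩

theorem pcontinuous_valuePFun (hF : LocallyCompactZeroDim F) : PContinuous (valuePFun h) := by
  intro O hO
  rw [isOpen_iff_forall_mem_open]
  rintro x ⟨y, hy, hxy⟩
  obtain ⟨U, hU, hyU, hUO⟩ := hF.exists_section hO hy
  refine ⟨(valuePFun h).preimage U, PFun.preimage_mono _ hUO, ?_, ⟨y, hyU, hxy⟩⟩
  rw [preimage_valuePFun hF ⟨U, hU⟩]
  exact (h.toFun _).2.isOpen

/-- Finitely many sections cover `K` and have compact preimages. Within the preimage of their union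
`W`, removing the open preimage of the complement of `K` leaves exactly the preimage of `K`. -/
theorem isCompact_preimage_valuePFun (hF : LocallyCompactZeroDim F) {K : Set F.X}
    (hK : IsCompact K) : IsCompact ((valuePFun h).preimage K) := by
  obtain ⟨W, hW, hKW⟩ : ∃ W, IsCompact ((valuePFun h).preimage W) ∧ K ⊆ W := by
    refine hK.induction_on (p := fun S => ∃ W, IsCompact ((valuePFun h).preimage W) ∧ S ⊆ W)
      ⟨∅, ?_, subset_rfl⟩ ?_ ?_ ?_
    · convert isCompact_empty
      exact eq_empty_of_forall_notMem fun x ⟨y, hy, _⟩ => hy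
    · rintro S T hST ⟨W, hW, hTW⟩
      exact ⟨W, hW, hST.trans hTW⟩
    · rintro S T ⟨W, hW, hSW⟩ ⟨W', hW', hTW'⟩
      refine ⟨W ∪ W', ?_, union_subset_union hSW hTW'⟩
      rw [PFun.preimage_union]
      exact hW.union hW'
    · intro y _
      obtain ⟨U, hU, hyU, -⟩ := hF.exists_section isOpen_univ (mem_univ y)
      refine ⟨U, mem_nhdsWithin_of_mem_nhds (hU.isOpen.mem_nhds hyU), U, ?_, subset_rfl⟩
      exact preimage_valuePFun (h := h) hF ⟨U, hU⟩ ▸ (h.toFun ⟨U, hU⟩).2.isCompact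
  have hK' : (valuePFun h).preimage K =
      (valuePFun h).preimage W \ (valuePFun h).preimage Kᶜ := by
    ext x
    constructor
    · rintro ⟨y, hy, hxy⟩
      exact ⟨⟨y, hKW hy, hxy⟩, fun ⟨z, hz, hxz⟩ => hz (Part.mem_unique hxy hxz ▸ hy)⟩
    · rintro ⟨⟨y, -, hxy⟩, hx⟩
      exact ⟨y, by_contra fun hy => hx ⟨y, hy, hxy⟩, hxy⟩
  rw [hK']
  exact hW.diff (pcontinuous_valuePFun hF _ hK.isClosed.isOpen_compl)

/-- If the projections differed, `y` and `y'` would lie in sections `U`, `U'` over disjoint sets, so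
`U ▷ U'` would be empty; yet its image under `h` contains `x'`. -/
theorem proj_eq_of_isValue (hF : LocallyCompactZeroDim F) {x x' : E.X} {y y' : F.X}
    (hy : IsValue h x y) (hy' : IsValue h x' y') (hx : E.proj x = E.proj x') :
    F.proj y = F.proj y' := by
  by_contra hne
  obtain ⟨O, O', hO, hO', hyO, hyO', hdisj⟩ := t2_separation hne
  have hc := F.isLocalHomeomorph.continuous
  obtain ⟨U, hU, hyU, hUO⟩ := hF.exists_section (hO.preimage hc) hyO
  obtain ⟨U', hU', hyU', hUO'⟩ := hF.exists_section (hO'.preimage hc) hyO'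
  have hmem : x' ∈ (h.toFun (F.sectionAlgebra.rest ⟨U, hU⟩ ⟨U', hU'⟩)).1 :=
    mem_hom_rest.2 ⟨(hy'.2 _).2 hyU', x, (hy.2 _).2 hyU, hx⟩
  obtain ⟨-, z, hz, hzy⟩ := (hy'.2 _).1 hmem
  exact disjoint_left.1 hdisj (hUO hz) (hzy ▸ hyO')

theorem exists_isValue_of_proj_eq (hF : LocallyCompactZeroDim F) {x : E.X} {y y' : F.X}
    (hy : IsValue h x y) (hyy' : F.proj y' = F.proj y) :
    ∃ x', E.proj x' = E.proj x ∧ IsValue h x' y' := by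
  obtain ⟨U, hxU⟩ := hy.1
  have hyU := (hy.2 U).1 hxU
  -- For `V` containing `y'`, the section `V ▷ U` contains `y`, so `x` lies in its image and hence
  -- over the image of `V`.
  have lift : ∀ V : F.sectionAlgebra.carrier, y' ∈ V.1 →
      ∃ x' ∈ (h.toFun V).1, E.proj x' = E.proj x := by
    intro V hV
    exact (mem_hom_rest.1 ((hy.2 (F.sectionAlgebra.rest V U)).2 ⟨hyU, y', hV, hyy'⟩)).2
  obtain ⟨V, hV, hyV, -⟩ := hF.exists_section isOpen_univ (mem_univ y')
  obtain ⟨x', hx', hxx'⟩ := lift ⟨V, hV⟩ hyV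
  obtain ⟨z, hz⟩ := exists_isValue hx'
  refine ⟨x', hxx', ?_⟩
  suffices y' = z from this ▸ hz
  refine hF.eq_of_forall fun W hW hyW => ?_
  -- Lifting through `V ∩ W` gives the same point `x'`, because the projection is injective on the
  -- image of `V`.
  let M := F.sectionAlgebra.diff ⟨V, hV⟩ (F.sectionAlgebra.diff ⟨V, hV⟩ ⟨W, hW⟩)
  obtain ⟨w, hw, hwx⟩ := lift M ⟨hyV, fun h' => h'.2 hyW⟩
  obtain rfl : w = x' :=
    (h.toFun ⟨V, hV⟩).2.injOn (mem_hom_diff.1 hw).1 hx' (hwx.trans hxx'.symm)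
  have hzM := (hz.2 M).1 hw
  exact by_contra fun h' => hzM.2 ⟨hzM.1, h'⟩

variable (h) in
/-- The morphism of étale spaces whose preimage map is `h`. -/
noncomputable def homOfSectionHom (hF : LocallyCompactZeroDim F) : Hom E F where
  toPFun := valuePFun h
  continuous := pcontinuous_valuePFun hF
  proper _ hK := isCompact_preimage_valuePFun hF hK
  preserves_equiv x x' y y' hy hy' hx :=
    proj_eq_of_isValue hF ((mem_valuePFun hF).1 hy) ((mem_valuePFun hF).1 hy') hx
  fibre_injective x x' y hy hy' hx := by
    rw [mem_valuePFun hF] at hy hy'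
    obtain ⟨U, hxU⟩ := hy.1
    exact (h.toFun U).2.injOn hxU ((hy'.2 U).2 ((hy.2 U).1 hxU)) hx
  fibre_surjective x y hy y' hyy' := by
    simp only [mem_valuePFun hF] at hy ⊢
    exact exists_isValue_of_proj_eq hF hy hyy'

theorem preimageHom_homOfSectionHom (hF : LocallyCompactZeroDim F) :
    (homOfSectionHom h hF).preimageHom = h :=
  PrefAlg.Hom.ext (funext fun U => Subtype.ext (preimage_valuePFun hF U))

end OfHom

end HausEt

instance : sectionFunctor.{u}.Faithful where
  map_injective {_ F} _ _ h := ObjectProperty.hom_ext _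
    (HausEt.Hom.ext_of_preimage F.property (congrArg Quiver.Hom.unop h))

instance : sectionFunctor.{u}.Full where
  map_surjective {_ F} f := ⟨ObjectProperty.homMk
    (HausEt.homOfSectionHom f.unop F.property),
    Quiver.Hom.unop_inj (HausEt.preimageHom_homOfSectionHom F.property)⟩

/-! ### The étale space of an algebra -/

namespace PrefAlg

/-! ### Identities between the operations, checked in a representation. -/

variable {A : PrefAlg.{u}}

/-- The meet of two elements. -/
def meet (a b : A.carrier) : A.carrier := A.diff a (A.diff a b)

theorem meet_comm (a b : A.carrier) : meet a b = meet b a := by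
  obtain ⟨X, Y, θ, hθ⟩ := A.representable
  apply hθ.injective
  ext ⟨x, y⟩
  simp only [meet, hθ.map_diff, pfDiff, Set.mem_ofPred_eq]
  tauto

theorem rest_self (a : A.carrier) : A.rest a a = a := by
  obtain ⟨X, Y, θ, hθ⟩ := A.representable
  apply hθ.injective
  ext ⟨x, y⟩
  simp only [hθ.map_rest, pfRest, pfDom, Set.mem_ofPred_eq]
  exact ⟨fun h => h.2, fun h => ⟨⟨y, h⟩, h⟩⟩

theorem rest_meet (a b c : A.carrier) : A.rest a (meet b c) = meet (A.rest a b) c := by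
  obtain ⟨X, Y, θ, hθ⟩ := A.representable
  apply hθ.injective
  ext ⟨x, y⟩
  simp only [meet, hθ.map_rest, hθ.map_diff, pfRest, pfDiff, Set.mem_ofPred_eq]
  tauto

theorem meet_rest_self (a b : A.carrier) : meet (A.rest a b) b = A.rest a b := by
  obtain ⟨X, Y, θ, hθ⟩ := A.representable
  apply hθ.injective
  ext ⟨x, y⟩
  simp only [meet, hθ.map_rest, hθ.map_diff, pfRest, pfDiff, Set.mem_ofPred_eq]
  tauto

theorem meet_rest_right (a b : A.carrier) : A.rest (meet a b) b = meet a b := by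
  obtain ⟨X, Y, θ, hθ⟩ := A.representable
  apply hθ.injective
  ext ⟨x, y⟩
  simp only [meet, hθ.map_rest, hθ.map_diff, pfRest, pfDiff, pfDom, Set.mem_ofPred_eq]
  constructor
  · rintro ⟨⟨z, hz⟩, hy⟩
    have hzb : (x, z) ∈ θ b := by tauto
    obtain rfl := hθ.isPartialFun b _ _ _ hzb hy
    exact hz
  · intro h
    exact ⟨⟨y, h⟩, by tauto⟩

theorem rest_assoc (a b c : A.carrier) : A.rest (A.rest a b) c = A.rest a (A.rest b c) := by
  obtain ⟨X, Y, θ, hθ⟩ := A.representable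
  apply hθ.injective
  ext ⟨x, y⟩
  simp only [hθ.map_rest, pfRest, pfDom, Set.mem_ofPred_eq]
  constructor
  · rintro ⟨⟨z, h, hz⟩, hy⟩
    exact ⟨h, ⟨z, hz⟩, hy⟩
  · rintro ⟨h, ⟨z, hz⟩, hy⟩
    exact ⟨⟨z, h, hz⟩, hy⟩

/-- Single-valuedness of `a` makes the domain of `(c - d) · a` the difference of the domains of `c ·
a` and `d · a`. This is what makes the lifted map in `exists_trace_eq` respect difference. -/
theorem rest_meet_diff (a b c d : A.carrier) :
    A.rest (meet (A.diff c d) a) b = A.diff (A.rest (meet c a) b) (A.rest (meet d a) b) := by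
  obtain ⟨X, Y, θ, hθ⟩ := A.representable
  apply hθ.injective
  ext ⟨x, y⟩
  simp only [meet, hθ.map_rest, hθ.map_diff, pfRest, pfDiff, pfDom, Set.mem_ofPred_eq]
  constructor
  · rintro ⟨⟨z, hz⟩, hy⟩
    refine ⟨⟨⟨z, by tauto⟩, hy⟩, ?_⟩
    rintro ⟨⟨w, hw⟩, -⟩
    obtain rfl := hθ.isPartialFun a x z w (by tauto) (by tauto)
    tauto
  · rintro ⟨⟨⟨z, hz⟩, hy⟩, h⟩
    refine ⟨⟨z, ⟨by_contra fun h' => h ⟨⟨z, by tauto⟩, hy⟩, ?_⟩⟩, hy⟩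
    have : (x, z) ∉ θ d := fun h' => h ⟨⟨z, by tauto⟩, hy⟩
    tauto

theorem meet_pref (a b : A.carrier) : meet a (A.pref a b) = a := by
  obtain ⟨X, Y, θ, hθ⟩ := A.representable
  apply hθ.injective
  ext ⟨x, y⟩
  simp only [meet, hθ.map_pref, hθ.map_diff, pfPref, pfDiff, Set.mem_ofPred_eq]
  tauto

theorem pref_diff (a b : A.carrier) :
    A.diff (A.pref a b) a = A.diff b (A.rest a b) := by
  obtain ⟨X, Y, θ, hθ⟩ := A.representable
  apply hθ.injective
  ext ⟨x, y⟩
  simp only [hθ.map_pref, hθ.map_diff, hθ.map_rest, pfPref, pfRest, pfDiff, Set.mem_ofPred_eq]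
  have : (x, y) ∈ θ a → x ∈ pfDom (θ a) := fun h => ⟨y, h⟩
  tauto

variable (A) in
/-- The maximal filters of an algebra, as `Bool`-valued maps. -/
abbrev Spec : Type u :=
  {p : A.carrier → Bool // (∃ a, p a = true) ∧ ∀ a b, p (A.diff a b) = (p a && !p b)}

/-! ### The topology on the space of maximal filters. -/

namespace Spec

/-- The maximal filters containing `a`. -/
def basic (a : A.carrier) : Set (Spec A) := {p | p.1 a = true}

theorem mem_basic {a : A.carrier} {p : Spec A} : p ∈ basic a ↔ p.1 a = true := Iff.rfl

theorem exists_mem_basic (p : Spec A) : ∃ a, p ∈ basic a := p.2.1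

theorem basic_diff (a b : A.carrier) : basic (A.diff a b) = basic a \ basic b := by
  ext p
  simp [mem_basic, p.2.2]

theorem mem_diff {a b : A.carrier} {p : Spec A} :
    p ∈ basic (A.diff a b) ↔ p ∈ basic a ∧ p ∉ basic b := by
  rw [basic_diff]; rfl

theorem mem_meet {a b : A.carrier} {p : Spec A} :
    p ∈ basic (meet a b) ↔ p ∈ basic a ∧ p ∈ basic b := by
  rw [meet, mem_diff, mem_diff]; tauto

theorem ext_basic {p q : Spec A} (h : ∀ a, p ∈ basic a ↔ q ∈ basic a) : p = q :=
  Subtype.ext (funext fun a => Bool.eq_iff_iff.2 (h a))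

theorem continuous_apply (a : A.carrier) : Continuous fun p : Spec A => p.1 a :=
  (_root_.continuous_apply a).comp continuous_subtype_val

theorem isClopen_basic (a : A.carrier) : IsClopen (basic a) :=
  (isClopen_discrete {true}).preimage (continuous_apply a)

/-- Nontriviality of `p` is not visibly a closed condition, but it follows from `p a = true`; so
`basic a` is a closed subset of the compact cube of `Bool`-valued maps. -/
theorem isCompact_basic (a : A.carrier) : IsCompact (basic a) := by
  rw [Subtype.isCompact_iff]
  have : Subtype.val '' (basic a) = {p : A.carrier → Bool | p a = true} ∩
      ⋂ b, ⋂ c, {p | p (A.diff b c) = (p b && !p c)} := by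
    ext p
    simp only [Set.mem_image, Set.mem_inter_iff, Set.mem_ofPred_eq, Set.mem_iInter]
    constructor
    · rintro ⟨q, hq, rfl⟩
      exact ⟨hq, q.2.2⟩
    · rintro ⟨h, h'⟩
      exact ⟨⟨p, ⟨a, h⟩, h'⟩, h, rfl⟩
  rw [this]
  refine IsClosed.isCompact (IsClosed.inter (isClosed_eq (by fun_prop) (by fun_prop)) ?_)
  refine isClosed_iInter fun b => isClosed_iInter fun c => isClosed_eq (by fun_prop) ?_
  have h : Continuous fun x : Bool × Bool => x.1 && !x.2 := continuous_of_discreteTopology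
  exact h.comp (Continuous.prodMk (_root_.continuous_apply b) (_root_.continuous_apply c))

/-- A neighbourhood of `p` constrains finitely many coordinates; starting from any member of `p`, a
meet imposes the value `true` and a difference the value `false`. -/
theorem exists_basic_subset {p : Spec A} {U : Set (Spec A)} (hU : IsOpen U) (hp : p ∈ U) :
    ∃ a, p ∈ basic a ∧ basic a ⊆ U := by
  obtain ⟨V, hV, rfl⟩ := hU
  obtain ⟨I, u, hu, hI⟩ := isOpen_pi_iff.1 hV p.1 hp
  suffices h : ∃ a, p ∈ basic a ∧ ∀ q ∈ basic a, ∀ i ∈ I, q.1 i = p.1 i by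
    obtain ⟨a, ha, h⟩ := h
    refine ⟨a, ha, fun q hq => hI fun i hi => ?_⟩
    rw [h q hq i hi]
    exact (hu i hi).2
  clear hI hu
  classical
  induction I using Finset.induction_on with
  | empty => exact p.exists_mem_basic.imp fun a ha => ⟨ha, by simp⟩
  | insert i I _ ih =>
    obtain ⟨a, ha, h⟩ := ih
    by_cases hi : p ∈ basic i
    · refine ⟨meet a i, mem_meet.2 ⟨ha, hi⟩, fun q hq => ?_⟩
      rw [mem_meet] at hq
      rw [Finset.forall_mem_insert]
      exact ⟨(mem_basic.1 hq.2).trans (mem_basic.1 hi).symm, h q hq.1⟩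
    · refine ⟨A.diff a i, mem_diff.2 ⟨ha, hi⟩, fun q hq => ?_⟩
      rw [mem_diff] at hq
      rw [Finset.forall_mem_insert]
      exact ⟨(Bool.eq_false_of_not_eq_true hq.2).trans (Bool.eq_false_of_not_eq_true hi).symm, h q hq.1⟩

/-! ### The projection of the étale space. -/

/-- The filter of domains of a maximal filter. -/
noncomputable def trace (p : Spec A) (a : A.carrier) : Bool :=
  p.1 (A.rest a p.exists_mem_basic.choose)

theorem mem_of_mem_rest {p : Spec A} {a b : A.carrier} (h : p ∈ basic (A.rest a b)) :
    p ∈ basic b := by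
  rw [← meet_rest_self, mem_meet] at h
  exact h.2

/-- The choice of `b ∈ p` does not matter: two choices are compared through their meet, with which
restriction commutes. -/
theorem trace_eq {p : Spec A} {b : A.carrier} (hb : p ∈ basic b) (a : A.carrier) :
    p.trace a = p.1 (A.rest a b) := by
  have key : ∀ b c, p ∈ basic b → p ∈ basic c → p ∈ basic (A.rest a b) →
      p ∈ basic (A.rest a c) := by
    intro b c _ hc h
    have h' : p ∈ basic (A.rest a (meet b c)) := by
      rw [rest_meet, mem_meet]
      exact ⟨h, hc⟩
    rw [meet_comm, rest_meet, mem_meet] at h'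
    exact h'.1
  have hc := p.exists_mem_basic.choose_spec
  exact Bool.eq_iff_iff.2 ⟨key _ _ hc hb, key _ _ hb hc⟩

theorem mem_trace {p : Spec A} {b : A.carrier} (hb : p ∈ basic b) (a : A.carrier) :
    p.trace a = true ↔ p ∈ basic (A.rest a b) := by
  rw [trace_eq hb]; rfl

theorem mem_basic_rest {p : Spec A} {a b : A.carrier} :
    p ∈ basic (A.rest a b) ↔ p ∈ basic b ∧ p.trace a = true :=
  ⟨fun h => ⟨mem_of_mem_rest h, (mem_trace (mem_of_mem_rest h) a).2 h⟩,
    fun h => (mem_trace h.1 a).1 h.2⟩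

theorem trace_of_mem {p : Spec A} {a : A.carrier} (ha : p ∈ basic a) : p.trace a = true := by
  rwa [mem_trace ha, rest_self]

/-- Restricting `a` to the domain of `c · a` gives back `c · a`. Thus one member and the trace
recover the whole filter, whence `trace_injOn`. -/
theorem mem_basic_iff_trace {p : Spec A} {a : A.carrier} (ha : p ∈ basic a) (c : A.carrier) :
    p ∈ basic c ↔ p.trace (meet c a) = true := by
  rw [mem_trace ha, meet_rest_right, mem_meet]
  exact (and_iff_left ha).symm

theorem trace_injOn (a : A.carrier) : Set.InjOn trace (basic a) := fun p hp q hq h =>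
  ext_basic fun c => by rw [mem_basic_iff_trace hp, mem_basic_iff_trace hq, h]

/-- The lift of the trace of `q` into `basic a` consists of those `c` for which the domain of `c ·
a` lies in that trace. -/
theorem exists_trace_eq {q : Spec A} {a : A.carrier} (h : q.trace a = true) :
    ∃ p ∈ basic a, p.trace = q.trace := by
  obtain ⟨b, hb⟩ := q.exists_mem_basic
  have hab := (mem_trace hb a).1 h
  have haa : meet a a = a := by simpa only [rest_self] using meet_rest_self a a
  have hdiff : ∀ c d,
      q.trace (meet (A.diff c d) a) = (q.trace (meet c a) && !q.trace (meet d a)) := by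
    intro c d
    rw [trace_eq hb, trace_eq hb, trace_eq hb, rest_meet_diff, q.2.2]
  have hp : q.trace (meet a a) = true := by rwa [haa]
  let p : Spec A := ⟨fun c => q.trace (meet c a), ⟨a, hp⟩, hdiff⟩
  refine ⟨p, hp, funext fun x => ?_⟩
  rw [trace_eq (p := p) hp]
  change q.trace (meet (A.rest x a) a) = _
  rw [meet_rest_self, trace_eq hb, rest_assoc, trace_eq hab]

/-- On the open set `basic b`, coordinate `a` of the trace is the coordinate `a ▷ b` of the filter.
-/
theorem continuous_trace : Continuous (trace (A := A)) := by
  refine continuous_pi fun a => continuous_iff_continuousAt.2 fun p => ?_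
  obtain ⟨b, hb⟩ := p.exists_mem_basic
  refine (continuous_apply (A.rest a b)).continuousAt.congr ?_
  filter_upwards [(isClopen_basic b).isOpen.mem_nhds hb] with q hq
  exact (trace_eq hq a).symm

theorem image_trace_basic (a : A.carrier) :
    Set.rangeFactorization trace '' basic a = {t : Set.range (trace (A := A)) | t.1 a = true} := by
  ext ⟨_, q, rfl⟩
  constructor
  · rintro ⟨p, hp, h⟩
    have : p.trace = q.trace := congrArg Subtype.val h
    change q.trace a = true
    rw [← this]
    exact trace_of_mem hp
  · intro h
    obtain ⟨p, hp, h⟩ := exists_trace_eq h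
    exact ⟨p, hp, Subtype.ext h⟩

theorem isTopologicalBasis_basic :
    TopologicalSpace.IsTopologicalBasis (Set.range (basic (A := A))) := by
  refine TopologicalSpace.isTopologicalBasis_of_isOpen_of_nhds ?_ fun p U hp hU => ?_
  · rintro _ ⟨a, rfl⟩
    exact (isClopen_basic a).isOpen
  · obtain ⟨a, ha, haU⟩ := exists_basic_subset hU hp
    exact ⟨_, ⟨a, rfl⟩, ha, haU⟩

theorem isOpenMap_trace : IsOpenMap (Set.rangeFactorization (trace (A := A))) := by
  rw [isTopologicalBasis_basic.isOpenMap_iff]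
  rintro _ ⟨a, rfl⟩
  rw [image_trace_basic]
  have hc : Continuous fun t : Set.range (trace (A := A)) => t.1 a :=
    (_root_.continuous_apply a).comp continuous_subtype_val
  exact (isOpen_discrete {true}).preimage hc

theorem isLocalHomeomorph_trace :
    IsLocalHomeomorph (Set.rangeFactorization (trace (A := A))) := by
  rw [isLocalHomeomorph_iff_isOpenEmbedding_restrict]
  intro p
  obtain ⟨a, ha⟩ := p.exists_mem_basic
  have hopen := (isClopen_basic a).isOpen
  refine ⟨basic a, hopen.mem_nhds ha, .of_continuous_injective_isOpenMap
    ((continuous_trace.subtype_mk _).comp continuous_subtype_val) ?_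
    (isOpenMap_trace.comp hopen.isOpenMap_subtype_val)⟩
  intro q r h
  exact Subtype.ext (trace_injOn a q.2 r.2 (congrArg Subtype.val h))

end Spec

/-! ### The étale space of an algebra and its sections. -/

open Spec

variable (A) in
/-- The étale space of an algebra. -/
noncomputable def etaleSpace : HausEt.{u} where
  X := Spec A
  X₀ := Set.range (trace (A := A))
  proj := Set.rangeFactorization trace
  isLocalHomeomorph := isLocalHomeomorph_trace
  surjective := Set.rangeFactorization_surjective

theorem locallyCompactZeroDim_etaleSpace : A.etaleSpace.LocallyCompactZeroDim := by
  constructor <;> intro p U hU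
  all_goals
    obtain ⟨O, hOU, hO, hp⟩ := mem_nhds_iff.1 hU
    obtain ⟨a, ha, haO⟩ := exists_basic_subset hO hp
    have hnhds := (isClopen_basic a).isOpen.mem_nhds ha
  · exact ⟨basic a, hnhds, haO.trans hOU, isCompact_basic a⟩
  · exact ⟨basic a, hnhds, haO.trans hOU, isClopen_basic a⟩

theorem isCompactOpenSection_basic (a : A.carrier) :
    A.etaleSpace.IsCompactOpenSection (basic a) :=
  ⟨isCompact_basic a, (isClopen_basic a).isOpen,
    fun _ hp _ hq h => trace_injOn a hp hq (congrArg Subtype.val h)⟩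

theorem mem_saturation_basic {a : A.carrier} {p : Spec A} :
    A.etaleSpace.proj p ∈ A.etaleSpace.proj '' basic a ↔ p.trace a = true :=
  Set.ext_iff.1 (image_trace_basic a) (Set.rangeFactorization trace p)

theorem basic_pref (a b : A.carrier) : basic (A.pref a b) =
    basic a ∪ basic b \ A.etaleSpace.proj ⁻¹' (A.etaleSpace.proj '' basic a) := by
  ext p
  have h₁ := mem_meet (a := a) (b := A.pref a b) (p := p)
  have h₂ := mem_diff (a := A.pref a b) (b := a) (p := p)
  rw [meet_pref] at h₁
  rw [pref_diff, mem_diff, mem_basic_rest] at h₂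
  have h₃ := mem_saturation_basic (a := a) (p := p)
  change _ ↔ p ∈ basic a ∨ p ∈ basic b ∧
    ¬A.etaleSpace.proj p ∈ A.etaleSpace.proj '' basic a
  tauto

/-- An element of an algebra, as a compact open section of its étale space. -/
noncomputable def toSections (A : PrefAlg.{u}) : Hom A A.etaleSpace.sectionAlgebra where
  toFun a := ⟨basic a, isCompactOpenSection_basic a⟩
  map_diff _ _ := Subtype.ext (basic_diff _ _)
  map_rest _ _ := Subtype.ext <| Set.ext fun _ =>
    mem_basic_rest.trans (and_congr_right fun _ => mem_saturation_basic.symm)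
  map_pref _ _ := Subtype.ext (basic_pref _ _)

theorem toSections_injective : Function.Injective A.toSections.toFun := by
  intro a b h
  have hab : basic a = basic b := Subtype.ext_iff.1 h
  obtain ⟨X, Y, θ, hθ⟩ := A.representable
  classical
  -- Each point of the graph of an element gives a maximal filter.
  have key : ∀ a b, basic a = basic b → θ a ⊆ θ b := by
    intro a b h z hz
    let p : Spec A := ⟨fun c => decide (z ∈ θ c), ⟨a, by simpa using hz⟩, fun c d => by
      simp [hθ.map_diff, pfDiff]⟩
    have : p ∈ basic a := by simpa [p, mem_basic] using hz
    rw [h] at this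
    simpa [p, mem_basic] using this
  exact hθ.injective (Set.Subset.antisymm (key _ _ hab) (key _ _ hab.symm))

theorem toSections_surjective : Function.Surjective A.toSections.toFun := by
  rintro ⟨K, hK⟩
  suffices h : ∃ a, K ⊆ basic a ∧ basic a ⊆ K by
    obtain ⟨a, h⟩ := h
    exact ⟨a, Subtype.ext (Set.Subset.antisymm h.2 h.1)⟩
  refine hK.isCompact.induction_on (p := fun S => ∃ a, S ⊆ basic a ∧ basic a ⊆ K) ?_ ?_ ?_ ?_
  · obtain ⟨a⟩ := A.nonempty
    refine ⟨A.diff a a, Set.empty_subset _, ?_⟩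
    rw [basic_diff, Set.sdiff_self]
    exact Set.empty_subset _
  · rintro S T hST ⟨a, h⟩
    exact ⟨a, hST.trans h.1, h.2⟩
  · rintro S T ⟨a, hS, ha⟩ ⟨b, hT, hb⟩
    refine ⟨A.pref a b, ?_, ?_⟩
    · rw [basic_pref]
      rintro p (hp | hp)
      · exact Or.inl (hS hp)
      -- Both pieces lie in `K`, where the projection is injective, so `a` and `b` agree where their
      -- domains overlap and the override loses nothing.
      · by_cases h : A.etaleSpace.proj p ∈ A.etaleSpace.proj '' basic a
        · obtain ⟨q, hq, hqp⟩ := h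
          obtain rfl := hK.injOn (ha hq) (hb (hT hp)) hqp
          exact Or.inl hq
        · exact Or.inr ⟨hT hp, h⟩
    · rw [basic_pref]
      exact Set.union_subset ha (Set.sdiff_subset.trans hb)
  · intro p hp
    obtain ⟨a, ha, haK⟩ := exists_basic_subset hK.isOpen hp
    exact ⟨basic a, mem_nhdsWithin_of_mem_nhds ((isClopen_basic a).isOpen.mem_nhds ha), a,
      subset_rfl, haK⟩

/-- A bijective homomorphism of algebras is an isomorphism. -/
noncomputable def isoOfBijective {A B : PrefAlg.{u}} (f : Hom A B)
    (hf : Function.Bijective f.toFun) : A ≅ B :=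
  let e := Equiv.ofBijective f.toFun hf
  have he : ∀ b, f.toFun (e.symm b) = b := e.apply_symm_apply
  { hom := f
    inv :=
      { toFun := e.symm
        map_diff := fun a b => hf.1 (by rw [f.map_diff, he, he, he])
        map_rest := fun a b => hf.1 (by rw [f.map_rest, he, he, he])
        map_pref := fun a b => hf.1 (by rw [f.map_pref, he, he, he]) }
    hom_inv_id := Hom.ext (funext e.symm_apply_apply)
    inv_hom_id := Hom.ext (funext he) }

end PrefAlg

instance : sectionFunctor.{u}.EssSurj where
  mem_essImage A := ⟨⟨A.unop.etaleSpace, PrefAlg.locallyCompactZeroDim_etaleSpace⟩,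
    ⟨(PrefAlg.isoOfBijective A.unop.toSections
      ⟨PrefAlg.toSections_injective, PrefAlg.toSections_surjective⟩).op⟩⟩

/-! ### Preferential union in finitarily compatibly complete algebras -/

namespace DRAlg

variable {A : DRAlg.{u}}

theorem le_iff_of_representation {X Y : Type u} {θ : A.carrier → Set (X × Y)}
    (hθ : IsDRRepresentation A.diff A.rest θ) {a b : A.carrier} : a ≤ b ↔ θ a ⊆ θ b := by
  change A.diff a (A.diff a b) = a ↔ _
  rw [← hθ.injective.eq_iff, hθ.map_diff, hθ.map_diff]
  constructor
  · intro h z hz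
    rw [← h] at hz
    exact by_contra fun h' => hz.2 ⟨hz.1, h'⟩
  · intro h
    exact Set.Subset.antisymm (fun z hz => hz.1) fun z hz => ⟨hz, fun h' => h'.2 (h hz)⟩

/-- Joins of pairs are unions in every representation. -/
theorem representation_of_isLUB {X Y : Type u} {θ : A.carrier → Set (X × Y)}
    (hθ : IsDRRepresentation A.diff A.rest θ) {a b j : A.carrier} (hj : IsLUB {a, b} j) :
    θ j = θ a ∪ θ b := by
  have ha : θ a ⊆ θ j := (le_iff_of_representation hθ).1 (hj.1 (Or.inl rfl))
  have hb : θ b ⊆ θ j := (le_iff_of_representation hθ).1 (hj.1 (Or.inr rfl))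
  refine Set.Subset.antisymm ?_ (Set.union_subset ha hb)
  -- The union is cut out inside `j` using difference alone; it is therefore an upper bound in the
  -- algebra, and `j` lies below it.
  have hk : θ (A.diff j (A.diff (A.diff j a) b)) = θ a ∪ θ b := by
    simp only [hθ.map_diff]
    ext z
    have := @ha z
    have := @hb z
    simp only [pfDiff, Set.mem_ofPred_eq, Set.mem_union]
    tauto
  rw [← hk, ← le_iff_of_representation hθ]
  refine hj.2 ?_
  rintro c (rfl | rfl) <;> rw [le_iff_of_representation hθ, hk]
  exacts [Set.subset_union_left, Set.subset_union_right]

theorem isLUB_of_representation {X Y : Type u} {θ : A.carrier → Set (X × Y)}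
    (hθ : IsDRRepresentation A.diff A.rest θ) {S : Set A.carrier} {j : A.carrier}
    (hj : θ j = ⋃ a ∈ S, θ a) : IsLUB S j := by
  constructor
  · intro a ha
    rw [le_iff_of_representation hθ, hj]
    exact Set.subset_biUnion_of_mem (u := fun a => θ a) ha
  · intro b hb
    rw [le_iff_of_representation hθ, hj]
    exact Set.iUnion₂_subset fun a ha => (le_iff_of_representation hθ).1 (hb ha)

theorem mem_of_compatible {X Y : Type u} {θ : A.carrier → Set (X × Y)}
    (hθ : IsDRRepresentation A.diff A.rest θ) {a b : A.carrier} (h : A.Compatible a b)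
    {x : X} {y : Y} (hx : x ∈ pfDom (θ a)) (hy : (x, y) ∈ θ b) : (x, y) ∈ θ a := by
  have h' := congrArg θ h
  rw [hθ.map_rest, hθ.map_rest] at h'
  have : (x, y) ∈ pfRest (θ a) (θ b) := ⟨hx, hy⟩
  rw [h'] at this
  exact this.2

/-- The two elements have disjoint domains, so both restrictions are empty. -/
theorem compatible_diff_rest (a b : A.carrier) :
    A.Compatible a (A.diff b (A.rest a b)) := by
  obtain ⟨X, Y, θ, hθ⟩ := A.representable
  apply hθ.injective
  ext ⟨x, y⟩
  simp only [hθ.map_rest, hθ.map_diff, pfRest, pfDiff, pfDom, Set.mem_ofPred_eq]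
  constructor
  · rintro ⟨h, hb, h'⟩
    exact (h' ⟨h, hb⟩).elim
  · rintro ⟨⟨z, hz, h⟩, ha⟩
    exact (h ⟨⟨y, ha⟩, hz⟩).elim

theorem Compatible.symm {a b : A.carrier} (h : A.Compatible a b) : A.Compatible b a :=
  Eq.symm h

theorem FinCompComplete.exists_isLUB (hA : FinCompComplete A) (a b : A.carrier) :
    ∃ j, IsLUB {a, A.diff b (A.rest a b)} j := by
  refine hA _ (Set.toFinite _) ?_
  have h := compatible_diff_rest a b
  rintro c (rfl | rfl) d (rfl | rfl)
  exacts [rfl, h, h.symm, rfl]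

/-- Preferential union in a finitarily compatibly complete algebra. -/
noncomputable def FinCompComplete.pref (hA : FinCompComplete A) (a b : A.carrier) : A.carrier :=
  (hA.exists_isLUB a b).choose

theorem FinCompComplete.representation_pref (hA : FinCompComplete A) {X Y : Type u}
    {θ : A.carrier → Set (X × Y)} (hθ : IsDRRepresentation A.diff A.rest θ) (a b : A.carrier) :
    θ (hA.pref a b) = pfPref (θ a) (θ b) := by
  have h : θ (hA.pref a b) = _ := representation_of_isLUB hθ (hA.exists_isLUB a b).choose_spec
  rw [h, hθ.map_diff, hθ.map_rest]
  ext z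
  simp only [pfPref, pfDiff, pfRest, Set.mem_union, Set.mem_ofPred_eq]
  tauto

theorem Hom.map_le {A B : DRAlg.{u}} (f : Hom A B) {a b : A.carrier} (h : a ≤ b) :
    f.toFun a ≤ f.toFun b := by
  change B.diff _ (B.diff _ _) = _
  rw [← f.map_diff, ← f.map_diff]
  exact congrArg f.toFun h

/-- A homomorphism preserves joins of pairs, hence preferential unions. -/
theorem Hom.map_pref {A B : DRAlg.{u}} (f : Hom A B) (hA : FinCompComplete A)
    (hB : FinCompComplete B) (a b : A.carrier) :
    f.toFun (hA.pref a b) = hB.pref (f.toFun a) (f.toFun b) := by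
  obtain ⟨X, Y, θ, hθ⟩ := A.representable
  obtain ⟨X', Y', θ', hθ'⟩ := B.representable
  have hj := (hA.exists_isLUB a b).choose_spec
  change IsLUB _ (hA.pref a b) at hj
  generalize hA.pref a b = j at hj
  -- This equation, with `j` being an upper bound, characterises the join in terms preserved by `f`.
  have hk : A.diff j (A.diff (A.diff j a) (A.diff b (A.rest a b))) = j := by
    apply hθ.injective
    rw [hθ.map_diff, hθ.map_diff, hθ.map_diff j, representation_of_isLUB hθ hj]
    ext z
    simp only [pfDiff, Set.mem_union, Set.mem_ofPred_eq]
    tauto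
  apply hθ'.injective
  have ha := (le_iff_of_representation hθ').1 (f.map_le (hj.1 (Or.inl rfl)))
  have hb := (le_iff_of_representation hθ').1 (f.map_le (hj.1 (Or.inr rfl)))
  have hj' := congrArg (fun c => θ' (f.toFun c)) hk
  simp only [f.map_diff, f.map_rest, hθ'.map_diff, hθ'.map_rest] at hb hj'
  rw [hB.representation_pref hθ']
  ext z
  have ha := @ha z
  have hb := @hb z
  have hj' := Set.ext_iff.1 hj' z
  simp only [pfPref, pfDiff, pfRest, Set.mem_ofPred_eq] at ha hb hj' ⊢
  tauto

end DRAlg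

/-! ### The forgetful functor and its inverse. -/

namespace PrefAlg

/-- On compatible elements the override is the union, so joins are built by induction, starting from
`a - a` for the empty set. -/
theorem finCompComplete_forgetPref (A : PrefAlg.{u}) :
    DRAlg.FinCompComplete (forgetPref.obj A) := by
  intro S hS hcomp
  obtain ⟨X, Y, θ, hθ⟩ := A.representable
  have hθ' : IsDRRepresentation (forgetPref.obj A).diff (forgetPref.obj A).rest θ :=
    hθ.toIsDRRepresentation
  suffices h : ∃ j, θ j = ⋃ a ∈ S, θ a by
    obtain ⟨j, hj⟩ := h
    exact ⟨j, DRAlg.isLUB_of_representation hθ' hj⟩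
  induction S, hS using Set.Finite.induction_on with
  | empty =>
    obtain ⟨a⟩ := A.nonempty
    refine ⟨A.diff a a, ?_⟩
    rw [hθ.map_diff]
    ext z
    simp [pfDiff]
  | @insert a S _ _ ih =>
    obtain ⟨j, hj⟩ := ih fun b hb c hc => hcomp b (Or.inr hb) c (Or.inr hc)
    refine ⟨A.pref a j, (hθ.map_pref a j).trans (Eq.trans ?_
      ((congrArg (θ a ∪ ·) hj).trans (Set.biUnion_insert a S θ).symm))⟩
    refine Set.Subset.antisymm (fun z hz => hz.imp_right And.left) ?_
    rintro ⟨x, y⟩ (hz | hz)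
    · exact Or.inl hz
    · by_cases hx : x ∈ pfDom (θ a)
      · rw [hj] at hz
        obtain ⟨b, hb, hz⟩ := Set.mem_iUnion₂.1 hz
        exact Or.inl (DRAlg.mem_of_compatible hθ' (hcomp a (Or.inl rfl) b (Or.inr hb)) hx hz)
      · exact Or.inr ⟨hz, hx⟩

/-- Forgetting preferential union, with values in finitarily compatibly complete algebras. -/
def forgetPrefFinComp : PrefAlg.{u} ⥤ CfinDRAlg.{u} :=
  DRAlg.FinCompComplete.lift forgetPref finCompComplete_forgetPref

end PrefAlg

namespace DRAlg

/-- A finitarily compatibly complete algebra with its preferential union. -/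
noncomputable def addPref : CfinDRAlg.{u} ⥤ PrefAlg.{u} where
  obj A :=
    { carrier := A.obj.carrier
      diff := A.obj.diff
      rest := A.obj.rest
      pref := A.property.pref
      nonempty := A.obj.nonempty
      representable := by
        obtain ⟨X, Y, θ, hθ⟩ := A.obj.representable
        exact ⟨X, Y, θ, hθ, A.property.representation_pref hθ⟩ }
  map {A B} f := ⟨Hom.toFun f.hom, Hom.map_diff f.hom, Hom.map_rest f.hom,
    Hom.map_pref f.hom A.property B.property⟩

end DRAlg

namespace PrefAlg

theorem pref_forgetPref (A : PrefAlg.{u}) : (finCompComplete_forgetPref A).pref = A.pref := by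
  obtain ⟨X, Y, θ, hθ⟩ := A.representable
  funext a b
  exact hθ.injective (((finCompComplete_forgetPref A).representation_pref
    hθ.toIsDRRepresentation a b).trans (hθ.map_pref a b).symm)

/-- Adding back the forgotten operation returns the original algebra only up to a proved equality,
so morphisms must be compared by `HEq`. -/
theorem heq_of_toFun_eq {A B A' B' : PrefAlg.{u}} (hA : A = A') (hB : B = B') (f : A ⟶ B)
    (g : A' ⟶ B') (h : HEq (Hom.toFun f) (Hom.toFun g)) : HEq f g := by
  subst hA hB
  exact heq_of_eq (Hom.ext (eq_of_heq h))

theorem forgetPrefFinComp_comp_addPref : forgetPrefFinComp ⋙ DRAlg.addPref = 𝟭 PrefAlg.{u} := by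
  have hobj : ∀ A : PrefAlg.{u}, (forgetPrefFinComp ⋙ DRAlg.addPref).obj A = A := by
    intro A
    have h := pref_forgetPref A
    obtain ⟨carrier, diff, rest, pref, _, _⟩ := A
    change PrefAlg.mk carrier diff rest _ _ _ = _
    congr
  exact Functor.hext hobj fun A B f => heq_of_toFun_eq (hobj A) (hobj B) _ _ HEq.rfl

end PrefAlg

/-- The category of representable algebras with preferential union is dually equivalent to that
of locally compact zero-dimensional Hausdorff étale spaces, and forgetting preferential union is
an isomorphism of it onto the category of finitarily compatibly complete difference-restriction
algebras. -/
theorem corollary4 :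
    Nonempty (PrefAlg.{u}ᵒᵖ ≌ StoneEt.{u}) ∧
      ∃ (U : PrefAlg.{u} ⥤ CfinDRAlg.{u}) (H : CfinDRAlg.{u} ⥤ PrefAlg.{u}),
        U ⋙ DRAlg.FinCompComplete.{u}.ι = PrefAlg.forgetPref.{u} ∧
          U ⋙ H = 𝟭 PrefAlg.{u} ∧ H ⋙ U = 𝟭 CfinDRAlg.{u} := by
  have : sectionFunctor.{u}.IsEquivalence := { }
  -- The composite on `CfinDRAlg` is the identity by `rfl`: adding and then forgetting the operation
  -- leaves the carrier, difference and restriction untouched.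
  exact ⟨⟨sectionFunctor.asEquivalence.symm⟩, PrefAlg.forgetPrefFinComp, DRAlg.addPref, rfl,
    PrefAlg.forgetPrefFinComp_comp_addPref, rfl⟩
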